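/- Let $K$ be a field of characteristic different from $2$ and let $\bar K$ be its algebraic closure. For each $m\ge 0$ let $\varepsilon_m\in\bar K$ be a primitive $2^m$-th root of $1$, chosen so that $\varepsilon_{m+1}^2=\varepsilon_m$ for all $m$. Suppose that $K$ is of the second kind with respect to $2$, i.e. $K(\varepsilon_i)=K(\varepsilon_2)$ for all $i>2$. Let $\langle g\rangle$ be a cyclic group of order $2^n$, and let $K^t\langle g\rangle$ be a twisted group algebra of $\langle g\rangle$ over $K$, i.e. an associative $K$-algebra with a basis $\{\bar x\mid x\in\langle g\rangle\}$ such that $\bar x\bar y=\gamma(x,y)\,\overline{xy}$ with $\gamma(x,y)\in K^*$. Let $\bar g^{2^n}=a$, where $a\in K^*$. Let $s=H_n(a)$ be the greatest integer in $[0,n]$ such that $a=\alpha^{2^s}$ for some $\alpha\in K(\varepsilon_2)$. The element $a$ is said to be of the first kind if $a=b^{2^s}$ for some $b\in K$, and of the second kind if $a=-b^{2^s}$ for some $b\in K$. A minimal idempotent is a nonzero idempotent $e$ such that every idempotent $f$ with $ef=fe=f$ is $0$ or $e$. Theorem 3.1. The minimal idempotents of $K^t\langle g\rangle$ are the following, listed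 without repetition; in particular all the coefficients below belong to $K$. 1) If $K=K(\varepsilon_2)$, then $a=b^{2^s}$ for some $b\in K$, and for every such $b$ they are $$e_i=\frac1{2^s}\sum_{j=0}^{2^s-1}\varepsilon_s^{-ij}\,b^{-j}\,\bar g^{\,2^{n-s}j},\qquad i=0,1,\dots,2^s-1.$$ 2) If $K\ne K(\varepsilon_2)$ and either $s=0$, or $s=1$ and $a$ is of the second kind, then the only minimal idempotent is $1$. 3) If $K\ne K(\varepsilon_2)$, $s\ge1$ and $a$ is of the first kind, then for every $b\in K$ with $b^{2^s}=a$ they are $$f_1=\frac1{2^s}\sum_{j=0}^{2^s-1}b^{-j}\,\bar g^{\,2^{n-s}j},\qquad f_2=\frac1{2^s}\sum_{j=0}^{2^s-1}(-1)^j\,b^{-j}\,\bar g^{\,2^{n-s}j},$$ $$e_i=\frac1{2^s}\sum_{j=0}^{2^s-1}\bigl(\varepsilon_s^{ij}+\varepsilon_s^{-ij}\bigr)b^{-j}\,\bar g^{\,2^{n-s}j},\qquad i=1,2,\dots,2^{s-1}-1.$$ 4) If $K\ne K(\varepsilon_2)$, $s\ge2$ and $a$ is of the second kind, then for every $b\in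 K$ with $-b^{2^s}=a$ they are $$e_i=\frac1{2^s}\sum_{j=0}^{2^s-1}\bigl(\varepsilon_s^{ij+j}+\varepsilon_s^{-ij}\bigr)\varepsilon_{s+1}^{-j}\,b^{-j}\,\bar g^{\,2^{n-s}j},\qquad i=0,1,\dots,2^{s-1}-1.$$ -/

import Mathlib

/-- A field `K` (of characteristic different from `p`) is of the second kind with respect to `p`:
`K(ε_i) = K(ε_2)` for all `i > 2`, where `ε_i` is a primitive `p ^ i`-th root of unity in the
algebraic closure of `K`. -/
def IsFieldOfSecondKind (K : Type*) [Field K] (p : ℕ) : Prop :=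
  ∀ i : ℕ, 2 < i → ∀ ζ ξ : AlgebraicClosure K,
    IsPrimitiveRoot ζ (p ^ i) → IsPrimitiveRoot ξ (p ^ 2) →
      IntermediateField.adjoin K {ζ} = IntermediateField.adjoin K {ξ}

open Classical in
/-- For an intermediate field `L` of the algebraic closure of `K`, the greatest integer `s` in
`[0, n]` such that `a ∈ L ^ (2 ^ s)`. For `L = K(ε_2)` this is the `n`-height `H_n(a)`. -/
noncomputable def twoHeight {K : Type*} [Field K]
    (L : IntermediateField K (AlgebraicClosure K)) (n : ℕ) (a : K) : ℕ :=
  Nat.findGreatest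
    (fun s => ∃ α ∈ L, α ^ (2 ^ s) = algebraMap K (AlgebraicClosure K) a) n

/-- An element `a` of height `s` is of the first kind if `a ∈ K ^ (2 ^ s)`. -/
def IsElementOfFirstKind {K : Type*} [Field K] (s : ℕ) (a : K) : Prop :=
  ∃ b : K, b ^ (2 ^ s) = a

/-- An element `a` of height `s` is of the second kind if `a ∈ -K ^ (2 ^ s)`. -/
def IsElementOfSecondKind {K : Type*} [Field K] (s : ℕ) (a : K) : Prop :=
  ∃ b : K, -b ^ (2 ^ s) = a

/-- The basis `x ↦ u x` (written `x̄` on paper) exhibits the associative `K`-algebra `A` as a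
twisted group algebra of the group `G` over `K`: the product of `x̄` and `ȳ` is a nonzero scalar
multiple of the basis element of `x * y`. -/
def IsTwistedGroupBasis {K G A : Type*} [Field K] [Group G] [Ring A] [Algebra K A]
    (u : Module.Basis G K A) : Prop :=
  ∃ γ : G → G → Kˣ, ∀ x y : G, u x * u y = (γ x y : K) • u (x * y)

/-- Minimal idempotents: the minimal nonzero elements for the usual order on idempotents
(`f ≤ e` if and only if `e * f = f` and `f * e = f`). -/
def IsMinimalIdempotent {A : Type*} [Ring A] (e : A) : Prop :=
  IsIdempotentElem e ∧ e ≠ 0 ∧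
    ∀ f : A, IsIdempotentElem f → e * f = f → f * e = f → f = 0 ∨ f = e

/-- The element `(1 / 2 ^ s) * ∑_{j = 0}^{2 ^ s - 1} c_j * b ^ (-j) * h ^ (2 ^ (n - s) * j)`
of a `K`-algebra. -/
noncomputable def cyclicSum {K A : Type*} [Field K] [Ring A] [Algebra K A]
    (n s : ℕ) (b : K) (h : A) (c : ℕ → K) : A :=
  (1 / 2 ^ s : K) •
    ∑ j ∈ Finset.range (2 ^ s), (c j * b ^ (-(j : ℤ))) • h ^ (2 ^ (n - s) * j)

/-! ### Idempotents and evaluations at the roots of `X ^ N - a`. -/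

section PolynomialRoots

open Polynomial

/-! The algebra is `K[X] / (X ^ (2 ^ n) - a)`, with `X` going to `u g`. The polynomial is separable,
so evaluations at its roots `θ` in an algebraic closure are jointly injective, and an idempotent is
a 0/1-valued function on the roots, constant on Galois orbits. Minimal idempotents are the
indicators of the orbits.

Put `L = K(ε 2)` and `y = θ ^ 2 ^ (n - s)`, a `2 ^ s`-th root of `a`. As `K` is of the second kind,
every such `y` lies in `L`. If `s < n`, maximality of `s` makes `y` a nonsquare in `L`; since `-1`
is a square there, `X ^ 2 ^ (n - s) - y` is irreducible over `L`
(`irreducible_X_pow_two_pow_sub_C`). Hence all `θ` above one `y` are conjugate, and only the orbits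
of the `y` matter (`bijOn_isMinimalIdempotent_of_conjugate_supports`).

Write `a = ± b ^ 2 ^ s`; then `y / b` runs over the `2 ^ s`-th roots of `± 1`. If `K = L`, each is
an orbit by itself. Otherwise the conjugation of `L / K` inverts every 2-power root of unity
(`map_eq_inv_of_two_pow_eq_one`), and the orbits are the sets `{ζ, ζ⁻¹}`. Finite Fourier sums in `y
/ b` are their indicators. -/

theorem bijOn_isMinimalIdempotent_of_evaluations {A F ι κ : Type*} [Ring A] [Field F]
    (φ : ι → A →+* F) (hφ : ∀ f, (∀ i, φ i f = 0) → f = 0)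
    (J : Set κ) (E : κ → A) (P : κ → ι → Prop)
    (h1 : ∀ j ∈ J, ∀ i, P j i → φ i (E j) = 1)
    (h0 : ∀ j ∈ J, ∀ i, ¬ P j i → φ i (E j) = 0)
    (hne : ∀ j ∈ J, ∃ i, P j i) (hcover : ∀ i, ∃ j ∈ J, P j i)
    (hdisj : ∀ j ∈ J, ∀ j' ∈ J, ∀ i, P j i → P j' i → j = j')
    (hconj : ∀ j ∈ J, ∀ i i', P j i → P j i' → ∀ f, φ i f = 1 → φ i' f = 1) :
    Set.BijOn E J {e | IsMinimalIdempotent e} := by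
  have hext : ∀ f f', (∀ i, φ i f = φ i f') → f = f' := fun f f' h =>
    sub_eq_zero.1 (hφ _ fun i => by rw [map_sub, h, sub_self])
  have hidem : ∀ f, IsIdempotentElem f → ∀ i, φ i f = 0 ∨ φ i f = 1 := fun f hf i =>
    IsIdempotentElem.iff_eq_zero_or_one.1 (hf.map (φ i))
  have hE : ∀ j ∈ J, IsIdempotentElem (E j) := by
    intro j hj
    refine hext _ _ fun i => ?_
    by_cases hP : P j i
    · simp [h1 j hj i hP]
    · simp [h0 j hj i hP]
  have hE0 : ∀ j ∈ J, E j ≠ 0 := by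
    intro j hj h
    obtain ⟨i, hi⟩ := hne j hj
    have := h1 j hj i hi
    simp [h] at this
  -- A value 1 at one point of a block spreads to the whole block by `hconj`, so `E j` lies below
  -- `f`. Both minimality of `E j` and surjectivity follow from this.
  have hle : ∀ j ∈ J, ∀ i, P j i → ∀ f, φ i f = 1 → E j * f = E j ∧ f * E j = E j := by
    intro j hj i hi f hf
    constructor <;> refine hext _ _ fun k => ?_ <;> by_cases hP : P j k <;>
      simp [h0 j hj k, hP, hconj j hj i k hi, hf]
  refine ⟨fun j hj => ⟨hE j hj, hE0 j hj, fun f hf hef hfe => ?_⟩, fun j hj j' hj' h => ?_,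
    fun f hf => ?_⟩
  · by_cases hf0 : ∀ i, φ i f = 0
    · exact Or.inl (hφ f hf0)
    · right
      push Not at hf0
      obtain ⟨i, hi⟩ := hf0
      have hP : P j i := by
        by_contra hP
        apply hi
        rw [← hef, map_mul, h0 j hj i hP, zero_mul]
      rw [← hef, (hle j hj i hP f ((hidem f hf i).resolve_left hi)).1]
  · obtain ⟨i, hi⟩ := hne j hj
    refine hdisj j hj j' hj' i hi ?_
    by_contra hP
    have := h1 j hj i hi
    rw [h, h0 j' hj' i hP] at this
    exact zero_ne_one this
  · obtain ⟨hf1, hf2, hf3⟩ := hf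
    have : ∃ i, φ i f ≠ 0 := by
      by_contra! h
      exact hf2 (hφ f h)
    obtain ⟨i, hi⟩ := this
    obtain ⟨j, hj, hP⟩ := hcover i
    have := hle j hj i hP f ((hidem f hf1 i).resolve_left hi)
    exact ⟨j, hj, (hf3 _ (hE j hj) this.2 this.1).resolve_left (hE0 j hj)⟩

-- Induction through `F(x)` with `x ^ 2 = c`. If `b ^ 2 = x` in `F(x)`, taking norms gives `N(b) ^ 2
-- = -c`, so `c = (ι * N(b)) ^ 2` is a square in `F`. The root `ι` of `-1` excludes the exceptional
-- case of `X ^ 4 + 4 * k ^ 4`.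
universe v in
theorem irreducible_X_pow_two_pow_sub_C {F : Type v} [Field F] (ι : F) (hι : ι ^ 2 = -1)
    (c : F) (hc : ∀ d, d ^ 2 ≠ c) (m : ℕ) : Irreducible (X ^ (2 ^ m) - C c) := by
  induction m generalizing F with
  | zero => simpa using irreducible_X_sub_C c
  | succ m IH =>
    rw [pow_succ]
    refine X_pow_mul_sub_C_irreducible (X_pow_sub_C_irreducible_of_prime Nat.prime_two hc) ?_
    intro E _ _ x hx
    -- Were `x` not integral, `minpoly` would take its default value 0, which does not have degree
    -- 2.
    have hint : IsIntegral F x := not_not.mp fun h ↦ by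
      simpa only [degree_zero, degree_X_pow_sub_C Nat.prime_two.pos,
        WithBot.natCast_ne_bot] using congr_arg degree (hx.symm.trans (dif_neg h))
    refine IH (algebraMap F _ ι) (by rw [← map_pow, hι, map_neg, map_one]) _ fun b hb => ?_
    have hN : (Algebra.norm F b) ^ 2 = - c := by
      rw [← map_pow, hb, ← IntermediateField.adjoin.powerBasis_gen hint,
        Algebra.PowerBasis.norm_gen_eq_coeff_zero_minpoly]
      simp [IntermediateField.minpoly_gen, hx]
    exact hc (ι * Algebra.norm F b) (by rw [mul_pow, hι, hN]; ring)

theorem X_pow_sub_C_dvd_of_forall_root {K Ω : Type*} [Field K] [Field Ω] [Algebra K Ω]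
    [IsAlgClosed Ω] {N : ℕ} (hN : (N : K) ≠ 0) {a : K} (ha : a ≠ 0) (q : K[X])
    (hq : ∀ θ : Ω, θ ^ N = algebraMap K Ω a → aeval θ q = 0) : X ^ N - C a ∣ q := by
  classical
  by_cases hq0 : q = 0
  · simp [hq0]
  have hsep : (X ^ N - C a : K[X]).Separable := separable_X_pow_sub_C a hN ha
  rw [← Polynomial.map_dvd_map' (algebraMap K Ω)]
  have hN0 : 0 < N := Nat.pos_of_ne_zero (by rintro rfl; simp at hN)
  have hp0 : (X ^ N - C a : K[X]) ≠ 0 := X_pow_sub_C_ne_zero hN0 a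
  refine (IsAlgClosed.splits _).dvd_of_roots_le_roots
    ((Polynomial.map_ne_zero_iff (algebraMap K Ω).injective).2 hp0) ?_
  rw [Multiset.le_iff_subset (nodup_roots hsep.map)]
  intro θ hθ
  rw [mem_roots', IsRoot.def, eval_map_algebraMap] at hθ ⊢
  refine ⟨(Polynomial.map_ne_zero_iff (algebraMap K Ω).injective).2 hq0, hq θ ?_⟩
  have := hθ.2
  simpa [sub_eq_zero] using this

theorem adjoin_generator_eq_top {K G A : Type*} [Field K] [Group G] [Finite G] [Ring A]
    [Algebra K A] (u : Module.Basis G K A) (hu : IsTwistedGroupBasis u) (g : G)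
    (hg : ∀ x : G, x ∈ Subgroup.zpowers g) : Algebra.adjoin K {u g} = ⊤ := by
  obtain ⟨γ, hγ⟩ := hu
  -- Only positive powers are treated: `u 1` need not be the unit of `A`. The element `g ^ 0` is
  -- reached below as `g ^ orderOf g`.
  have hmem : ∀ k : ℕ, u (g ^ (k + 1)) ∈ Algebra.adjoin K {u g} := by
    intro k
    induction k with
    | zero => simp
    | succ k ih =>
      have h := hγ (g ^ (k + 1)) g
      have h' : u (g ^ (k + 1 + 1)) = ((γ (g ^ (k + 1)) g)⁻¹ : Kˣ).1 • (u (g ^ (k + 1)) * u g) := by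
        rw [h, smul_smul, Units.inv_mul, one_smul, pow_succ]
      rw [h']
      exact Subalgebra.smul_mem _ (mul_mem ih (Algebra.self_mem_adjoin_singleton K (u g))) _
  rw [eq_top_iff]
  intro f _
  rw [← u.linearCombination_repr f]
  refine Subalgebra.sum_mem _ fun x _ => Subalgebra.smul_mem _ ?_ _
  obtain ⟨k, hk : g ^ k = x⟩ := mem_powers_iff_mem_zpowers.2 (hg x)
  have := hmem (k + (orderOf g - 1))
  rwa [add_assoc, Nat.sub_add_cancel (orderOf_pos g), pow_add, pow_orderOf_eq_one, mul_one, hk]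
    at this

/-- The map from `AdjoinRoot (X ^ N - C a)` is onto because `u g` generates, and both sides have
dimension `N`. Joint injectivity is separability of `X ^ N - a`. -/
theorem exists_evaluations {K G A Ω : Type*} [Field K] [Field Ω] [Algebra K Ω] [IsAlgClosed Ω]
    [Group G] [Finite G] [Ring A] [Algebra K A] (u : Module.Basis G K A)
    (hu : IsTwistedGroupBasis u) (g : G) (hg : ∀ x : G, x ∈ Subgroup.zpowers g)
    {N : ℕ} (hN : (N : K) ≠ 0) (hcard : Nat.card G = N)
    {a : K} (ha : a ≠ 0) (hga : u g ^ N = algebraMap K A a) :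
    ∃ φ : {θ : Ω // θ ^ N = algebraMap K Ω a} → A →ₐ[K] Ω,
      (∀ θ, φ θ (u g) = θ) ∧ ∀ f, (∀ θ, φ θ f = 0) → f = 0 := by
  have hN0 : 0 < N := Nat.pos_of_ne_zero (by rintro rfl; simp at hN)
  have hp0 : (X ^ N - C a : K[X]) ≠ 0 := X_pow_sub_C_ne_zero hN0 a
  let ψ : AdjoinRoot (X ^ N - C a) →ₐ[K] A :=
    Ideal.Quotient.liftₐ _ (aeval (u g)) (by
      intro q hq
      obtain ⟨r, rfl⟩ := Ideal.mem_span_singleton'.1 hq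
      simp [hga])
  have hψ : ∀ q, ψ (AdjoinRoot.mk _ q) = aeval (u g) q := fun q => rfl
  have hsurj : Function.Surjective ψ := by
    intro f
    have hf : f ∈ Algebra.adjoin K {u g} := adjoin_generator_eq_top u hu g hg ▸ Algebra.mem_top
    rw [Algebra.adjoin_singleton_eq_range_aeval] at hf
    obtain ⟨q, rfl⟩ := hf
    exact ⟨AdjoinRoot.mk _ q, hψ q⟩
  have hfin : Module.finrank K (AdjoinRoot (X ^ N - C a)) = Module.finrank K A := by
    have := Fintype.ofFinite G
    rw [(AdjoinRoot.powerBasis hp0).finrank, AdjoinRoot.powerBasis_dim, natDegree_X_pow_sub_C,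
      Module.finrank_eq_card_basis u, ← Nat.card_eq_fintype_card, hcard]
  have := (AdjoinRoot.powerBasis hp0).finite
  have := Module.Finite.of_basis u
  have hinj : Function.Injective ψ :=
    (LinearMap.injective_iff_surjective_of_finrank_eq_finrank (f := ψ.toLinearMap) hfin).2 hsurj
  let e := AlgEquiv.ofBijective ψ ⟨hinj, hsurj⟩
  have he : ∀ q, e.symm (aeval (u g) q) = AdjoinRoot.mk _ q := fun q =>
    (AlgEquiv.symm_apply_eq e).2 (hψ q).symm
  refine ⟨fun θ => (AdjoinRoot.liftAlgHom (X ^ N - C a) (Algebra.ofId K Ω) θ.1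
    (by simp [θ.2])).comp e.symm.toAlgHom, fun θ => ?_, fun f hf => ?_⟩
  · have := he X
    rw [aeval_X] at this
    simp [this]
  · obtain ⟨f, rfl⟩ := hsurj f
    obtain ⟨q, rfl⟩ := AdjoinRoot.mk_surjective f
    have : X ^ N - C a ∣ q := by
      refine X_pow_sub_C_dvd_of_forall_root (Ω := Ω) hN ha q fun θ hθ => ?_
      have := hf ⟨θ, hθ⟩
      rw [hψ, AlgHom.comp_apply] at this
      erw [he] at this
      simpa [aeval_def] using this
    rw [AdjoinRoot.mk_eq_zero.2 this, map_zero]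

/-! ### Galois conjugation over `K` and over `K(ι)`, where `ι ^ 2 = -1`. -/

section Conjugation

variable {K Ω : Type*} [Field K] [Field Ω] [Algebra K Ω]

theorem exists_algEquiv_of_two_pow_eq [IsAlgClosed Ω] [Algebra.IsAlgebraic K Ω]
    (L : IntermediateField K Ω) {ι c : Ω} (hιL : ι ∈ L) (hι : ι ^ 2 = -1)
    (hcL : c ∈ L) (hc : ∀ d ∈ L, d ^ 2 ≠ c) (m : ℕ) {θ θ' : Ω}
    (hθ : θ ^ 2 ^ m = c) (hθ' : θ' ^ 2 ^ m = c) : ∃ τ : Ω ≃ₐ[L] Ω, τ θ = θ' := by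
  have : Algebra.IsAlgebraic L Ω := Algebra.IsAlgebraic.tower_top (K := K) L
  have : IsAlgClosure L Ω := ⟨inferInstance, inferInstance⟩
  have hirr : Irreducible (X ^ (2 ^ m) - C (⟨c, hcL⟩ : L)) :=
    irreducible_X_pow_two_pow_sub_C (⟨ι, hιL⟩ : L) (Subtype.ext hι) _
      (fun d hd => hc d d.2 (congrArg Subtype.val hd)) m
  have hmin : ∀ ρ : Ω, ρ ^ 2 ^ m = c → X ^ (2 ^ m) - C (⟨c, hcL⟩ : L) = minpoly L ρ :=
    fun ρ hρ => minpoly.eq_of_irreducible_of_monic hirr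
      (by simp [hρ, IntermediateField.algebraMap_apply])
      (monic_X_pow_sub_C _ (by positivity))
  have : IsConjRoot L θ' θ := (hmin θ' hθ').symm.trans (hmin θ hθ)
  exact this.exists_algEquiv

theorem exists_algEquiv_of_pow_eq_of_height [IsAlgClosed Ω] [Algebra.IsAlgebraic K Ω]
    (L : IntermediateField K Ω) {ι c a : Ω} (hιL : ι ∈ L) (hι : ι ^ 2 = -1) {s n : ℕ}
    (hsn : s ≤ n) (hmax : s < n → ∀ α ∈ L, α ^ 2 ^ (s + 1) ≠ a)
    (hcL : c ∈ L) (hca : c ^ 2 ^ s = a) {θ θ' : Ω}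
    (hθ : θ ^ 2 ^ (n - s) = c) (hθ' : θ' ^ 2 ^ (n - s) = c) : ∃ τ : Ω ≃ₐ[K] Ω, τ θ = θ' := by
  rcases hsn.eq_or_lt with rfl | hlt
  · refine ⟨.refl, ?_⟩
    simp only [Nat.sub_self, pow_zero, pow_one] at hθ hθ'
    rw [hθ, hθ']
    rfl
  -- A square root `d` of `c` in `L` would give `d ^ 2 ^ (s + 1) = a`, against maximality of `s`.
  · obtain ⟨τ, hτ⟩ := exists_algEquiv_of_two_pow_eq L hιL hι hcL (fun d hd h =>
      hmax hlt d hd (by rw [pow_succ', pow_mul, h, hca])) (n - s) hθ hθ'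
    exact ⟨τ.restrictScalars K, hτ⟩

theorem exists_eq_add_mul_of_mem_adjoin {ι : Ω} (hι : ι ^ 2 = -1) {z : Ω}
    (hz : z ∈ IntermediateField.adjoin K {ι}) :
    ∃ v w : K, z = algebraMap K Ω v + algebraMap K Ω w * ι := by
  have hmonic : (X ^ 2 + 1 : K[X]).Monic := by monicity!
  have hroot : aeval ι (X ^ 2 + 1 : K[X]) = 0 := by simp [hι]
  have hint : IsIntegral K ι := ⟨_, hmonic, hroot⟩
  rw [← IntermediateField.mem_toSubalgebra,
    IntermediateField.adjoin_simple_toSubalgebra_of_isAlgebraic hint.isAlgebraic,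
    Algebra.adjoin_singleton_eq_range_aeval] at hz
  obtain ⟨q, rfl⟩ := hz
  have hdeg : (q %ₘ (X ^ 2 + 1)).natDegree ≤ 1 := by
    have h2 : (X ^ 2 + 1 : K[X]).natDegree = 2 := by compute_degree!
    have := natDegree_modByMonic_lt q hmonic (by intro h; simp [h] at h2)
    omega
  refine ⟨(q %ₘ (X ^ 2 + 1)).coeff 0, (q %ₘ (X ^ 2 + 1)).coeff 1, ?_⟩
  have hq : aeval ι q = aeval ι (q %ₘ (X ^ 2 + 1)) := by
    conv_lhs => rw [← modByMonic_add_div q (X ^ 2 + 1)]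
    simp [hι]
  conv_lhs => rw [AlgHom.toRingHom_eq_coe, RingHom.coe_coe, hq, eq_X_add_C_of_natDegree_le_one hdeg]
  simp [add_comm]

theorem neg_one_not_square_of_adjoin_ne_bot {ι : Ω} (hι : ι ^ 2 = -1)
    (hL : IntermediateField.adjoin K {ι} ≠ ⊥) (b : K) : b ^ 2 ≠ -1 := by
  intro hb
  apply hL
  rw [IntermediateField.adjoin_simple_eq_bot_iff, IntermediateField.mem_bot]
  have : ι ^ 2 = (algebraMap K Ω b) ^ 2 := by rw [← map_pow, hb, hι]; simp
  rcases sq_eq_sq_iff_eq_or_eq_neg.1 this with h | h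
  · exact ⟨b, h.symm⟩
  · exact ⟨-b, by rw [h, map_neg]⟩

theorem exists_algEquiv_map_eq_neg [Normal K Ω] {ι : Ω} (hι : ι ^ 2 = -1)
    (hK : ∀ b : K, b ^ 2 ≠ -1) : ∃ τ : Ω ≃ₐ[K] Ω, τ ι = -ι := by
  have hmin : ∀ ρ : Ω, ρ ^ 2 = -1 → X ^ 2 - C (-1 : K) = minpoly K ρ := fun ρ hρ =>
    minpoly.eq_of_irreducible_of_monic (X_pow_sub_C_irreducible_of_prime Nat.prime_two hK)
      (by simp [hρ]) (monic_X_pow_sub_C _ two_ne_zero)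
  have : IsConjRoot K (-ι) ι := (hmin (-ι) (by rw [neg_sq, hι])).symm.trans (hmin ι hι)
  exact this.exists_algEquiv

theorem exists_algebraMap_eq_of_fixed (h2 : (2 : K) ≠ 0) {ι : Ω} (hι : ι ^ 2 = -1)
    (τ : Ω ≃ₐ[K] Ω) (hτ : τ ι = -ι) {z : Ω} (hz : z ∈ IntermediateField.adjoin K {ι})
    (hfix : τ z = z) : ∃ k : K, algebraMap K Ω k = z := by
  obtain ⟨v, w, rfl⟩ := exists_eq_add_mul_of_mem_adjoin hι hz
  have h2' : (2 : Ω) ≠ 0 := by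
    have := (map_ne_zero (algebraMap K Ω)).2 h2
    rwa [map_ofNat] at this
  refine ⟨v, ?_⟩
  simp only [map_add, map_mul, AlgEquiv.commutes, hτ] at hfix
  have : 2 * (algebraMap K Ω w * ι) = 0 := by linear_combination -hfix
  rw [(mul_eq_zero.1 this).resolve_left h2', add_zero]

theorem sq_eq_one_of_two_pow_eq_one (hK : ∀ b : K, b ^ 2 ≠ -1) {ν : K} {m : ℕ}
    (hν : ν ^ 2 ^ m = 1) : ν ^ 2 = 1 := by
  induction m with
  | zero => simp_all
  | succ m ih =>
    rw [pow_succ, pow_mul] at hν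
    rcases mul_self_eq_one_iff.1 ((sq _).symm.trans hν) with h | h
    · exact ih h
    · cases m with
      | zero => rw [pow_zero, pow_one] at h; simp [h]
      | succ m => exact absurd (by rw [← pow_mul, ← pow_succ, h]) (hK (ν ^ 2 ^ m))

/-- The norm `τ ξ * ξ` of a 2-power root of unity lies in `K`, where the only such roots are `± 1`.
Applying this to a square root `ξ` of `ζ` and squaring removes the sign. -/
theorem map_eq_inv_of_two_pow_eq_one [IsAlgClosed Ω] (h2 : (2 : K) ≠ 0) {ι : Ω}
    (hι : ι ^ 2 = -1)
    (hL : ∀ (m : ℕ) (z : Ω), z ^ 2 ^ m = 1 → z ∈ IntermediateField.adjoin K {ι})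
    (hK : ∀ b : K, b ^ 2 ≠ -1) (τ : Ω ≃ₐ[K] Ω) (hτ : τ ι = -ι) {ζ : Ω} {m : ℕ}
    (hζ : ζ ^ 2 ^ m = 1) : τ ζ = ζ⁻¹ := by
  obtain ⟨ξ, hξ⟩ := IsAlgClosed.exists_pow_nat_eq ζ two_pos
  have hξ1 : ξ ^ 2 ^ (m + 1) = 1 := by rw [pow_succ', pow_mul, hξ, hζ]
  have hν : (τ ξ * ξ) ^ 2 ^ (m + 1) = 1 := by rw [mul_pow, ← map_pow, hξ1]; simp
  have hττ : τ (τ ξ) = ξ := by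
    obtain ⟨v, w, h⟩ := exists_eq_add_mul_of_mem_adjoin hι (hL _ _ hξ1)
    simp [h, hτ]
  obtain ⟨k, hk⟩ := exists_algebraMap_eq_of_fixed h2 hι τ hτ (hL _ _ hν)
    (by rw [map_mul, hττ, mul_comm])
  have hk2 : k ^ 2 = 1 := by
    refine sq_eq_one_of_two_pow_eq_one hK (m := m + 1) ((algebraMap K Ω).injective ?_)
    rw [map_pow, hk, hν, map_one]
  refine eq_inv_of_mul_eq_one_left ?_
  rw [← hξ, map_pow, ← mul_pow, ← hk, ← map_pow, hk2, map_one]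

end Conjugation

end PolynomialRoots

/-! ### Reduction to the Galois orbits of the `2 ^ s`-th roots of `a`. -/

theorem mem_adjoin_of_two_pow_eq_one {K : Type*} [Field K] (hK : IsFieldOfSecondKind K 2)
    {ε : ℕ → AlgebraicClosure K} (hε : ∀ m, IsPrimitiveRoot (ε m) (2 ^ m)) (m : ℕ)
    (z : AlgebraicClosure K) (hz : z ^ 2 ^ m = 1) : z ∈ IntermediateField.adjoin K {ε 2} := by
  -- Raising the level to `m + 3` puts it in the range `2 < i` covered by `hK`.
  have hz' : z ^ 2 ^ (m + 3) = 1 := by rw [pow_add, pow_mul, hz, one_pow]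
  obtain ⟨k, -, rfl⟩ := (hε (m + 3)).eq_pow_of_pow_eq_one hz'
  rw [← hK (m + 3) (by omega) (ε (m + 3)) (ε 2) (hε _) (hε _)]
  exact pow_mem (IntermediateField.mem_adjoin_simple_self K _) k

theorem bijOn_isMinimalIdempotent_of_conjugate_supports {K G A Ω : Type*} [Field K] [Field Ω]
    [Algebra K Ω] [IsAlgClosed Ω] [Algebra.IsAlgebraic K Ω] [Group G] [Ring A] [Algebra K A]
    (h2 : (2 : K) ≠ 0) (L : IntermediateField K Ω) {ι : Ω} (hιL : ι ∈ L) (hι : ι ^ 2 = -1)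
    {n : ℕ} {g : G} (hg : ∀ x : G, x ∈ Subgroup.zpowers g) (hcard : Nat.card G = 2 ^ n)
    {u : Module.Basis G K A} (hu : IsTwistedGroupBasis u)
    {a : K} (ha : a ≠ 0) (hga : u g ^ (2 ^ n) = algebraMap K A a) {s : ℕ} (hsn : s ≤ n)
    (hmax : s < n → ∀ α ∈ L, α ^ 2 ^ (s + 1) ≠ algebraMap K Ω a)
    (hroot : ∀ y : Ω, y ^ 2 ^ s = algebraMap K Ω a → y ∈ L)
    {κ : Type*} (J : Set κ) (E : κ → A) (P : κ → Ω → Prop)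
    (h1 : ∀ j ∈ J, ∀ φ : A →ₐ[K] Ω, (φ (u g) ^ 2 ^ (n - s)) ^ 2 ^ s = algebraMap K Ω a →
      P j (φ (u g) ^ 2 ^ (n - s)) → φ (E j) = 1)
    (h0 : ∀ j ∈ J, ∀ φ : A →ₐ[K] Ω, (φ (u g) ^ 2 ^ (n - s)) ^ 2 ^ s = algebraMap K Ω a →
      ¬ P j (φ (u g) ^ 2 ^ (n - s)) → φ (E j) = 0)
    (hne : ∀ j ∈ J, ∃ y, y ^ 2 ^ s = algebraMap K Ω a ∧ P j y)
    (hcover : ∀ y, y ^ 2 ^ s = algebraMap K Ω a → ∃ j ∈ J, P j y)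
    (hdisj : ∀ j ∈ J, ∀ j' ∈ J, ∀ y, y ^ 2 ^ s = algebraMap K Ω a → P j y → P j' y → j = j')
    (hconj : ∀ j ∈ J, ∀ y y', y ^ 2 ^ s = algebraMap K Ω a → y' ^ 2 ^ s = algebraMap K Ω a →
      P j y → P j y' → ∃ τ : Ω ≃ₐ[K] Ω, τ y = y') :
    Set.BijOn E J {e | IsMinimalIdempotent e} := by
  have : Finite G := Nat.finite_of_card_ne_zero (by rw [hcard]; positivity)
  have hN : ((2 ^ n : ℕ) : K) ≠ 0 := by push_cast; exact pow_ne_zero _ h2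
  obtain ⟨φ, hφ, hinj⟩ := exists_evaluations (Ω := Ω) u hu g hg hN hcard ha hga
  have hpow : ∀ θ : Ω, (θ ^ 2 ^ (n - s)) ^ 2 ^ s = θ ^ 2 ^ n := fun θ => by
    rw [← pow_mul, ← pow_add, Nat.sub_add_cancel hsn]
  have hy : ∀ θ : {θ : Ω // θ ^ 2 ^ n = algebraMap K Ω a},
      (θ.1 ^ 2 ^ (n - s)) ^ 2 ^ s = algebraMap K Ω a := fun θ => (hpow θ.1).trans θ.2
  refine bijOn_isMinimalIdempotent_of_evaluations (fun θ => (φ θ : A →+* Ω)) hinj J E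
    (fun j θ => P j (θ.1 ^ 2 ^ (n - s))) (fun j hj θ hP => ?_) (fun j hj θ hP => ?_)
    (fun j hj => ?_) (fun θ => hcover _ (hy θ)) (fun j hj j' hj' θ => hdisj j hj j' hj' _ (hy θ))
    (fun j hj θ θ' hP hP' f hf => ?_)
  · exact h1 j hj (φ θ) (by rw [hφ]; exact hy θ) (by rwa [hφ])
  · exact h0 j hj (φ θ) (by rw [hφ]; exact hy θ) (by rwa [hφ])
  · obtain ⟨y, hya, hP⟩ := hne j hj
    obtain ⟨θ, hθ⟩ := IsAlgClosed.exists_pow_nat_eq y (n := 2 ^ (n - s)) (by positivity)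
    exact ⟨⟨θ, by rw [← hpow, hθ, hya]⟩, by rwa [hθ]⟩
  -- `τ` carries `θ` into the fibre above `y'`, and `ρ` moves it within that fibre to `θ'`. So `φ
  -- θ'` is `φ θ` followed by an automorphism, which preserves the value 1.
  · obtain ⟨τ, hτ⟩ := hconj j hj _ _ (hy θ) (hy θ') hP hP'
    obtain ⟨ρ, hρ⟩ := exists_algEquiv_of_pow_eq_of_height L hιL hι hsn hmax (hroot _ (hy θ'))
      (hy θ') (θ := τ θ) (θ' := θ') (by rw [← map_pow, hτ]) rfl
    have hcomp : φ θ' = ((τ.trans ρ : Ω ≃ₐ[K] Ω) : Ω →ₐ[K] Ω).comp (φ θ) := by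
      refine AlgHom.ext_of_adjoin_eq_top (adjoin_generator_eq_top u hu g hg) ?_
      rintro _ rfl
      simp [hφ, hρ]
    have hf' : φ θ f = 1 := hf
    change φ θ' f = 1
    simp [hcomp, hf']

/-! ### The height is attained and maximal. -/

section TwoHeight

variable {K : Type*} [Field K] {L : IntermediateField K (AlgebraicClosure K)} {n : ℕ} {a : K}

theorem twoHeight_le : twoHeight L n a ≤ n := by
  classical exact Nat.findGreatest_le n

theorem exists_pow_twoHeight_eq :
    ∃ α ∈ L, α ^ 2 ^ twoHeight L n a = algebraMap K (AlgebraicClosure K) a := by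
  classical
  -- Exponent 0 always qualifies, with `α = a`, so the value of `Nat.findGreatest` is never a mere
  -- default.
  exact Nat.findGreatest_spec
    (P := fun s => ∃ α ∈ L, α ^ (2 ^ s) = algebraMap K (AlgebraicClosure K) a) (Nat.zero_le n)
    ⟨_, L.algebraMap_mem a, by simp⟩

theorem pow_ne_of_twoHeight_lt (h : twoHeight L n a < n) (α : AlgebraicClosure K) (hα : α ∈ L) :
    α ^ 2 ^ (twoHeight L n a + 1) ≠ algebraMap K (AlgebraicClosure K) a := by
  classical
  exact fun h' => Nat.findGreatest_is_greatest
    (P := fun s => ∃ α ∈ L, α ^ (2 ^ s) = algebraMap K (AlgebraicClosure K) a)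
    (Nat.lt_succ_self _) h ⟨α, hα, h'⟩

end TwoHeight

/-! ### Fourier sums over 2-power roots of unity. -/

theorem map_cyclicSum {K A Ω : Type*} [Field K] [Field Ω] [Algebra K Ω] [Ring A] [Algebra K A]
    (φ : A →ₐ[K] Ω) (n s : ℕ) (b : K) (h : A) (c : ℕ → K) :
    φ (cyclicSum n s b h c) = (1 / 2 ^ s) * ∑ j ∈ Finset.range (2 ^ s),
      algebraMap K Ω (c j) * (φ h ^ 2 ^ (n - s) / algebraMap K Ω b) ^ j := by
  rw [cyclicSum, map_smul, map_sum, Algebra.smul_def]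
  congr 1
  · rw [map_div₀, map_one, map_pow, map_ofNat]
  refine Finset.sum_congr rfl fun j _ => ?_
  rw [map_smul, Algebra.smul_def, map_mul, map_pow, div_pow, ← pow_mul, zpow_neg, zpow_natCast,
    map_inv₀, map_pow]
  ring

section GeometricMean

variable {F : Type*} [Field F] {s : ℕ}

theorem geometric_mean_of_eq_one (h2 : (2 : F) ≠ 0) {ω : F} (hω : ω = 1) :
    (1 / 2 ^ s) * ∑ j ∈ Finset.range (2 ^ s), ω ^ j = 1 := by
  simp [hω, h2]

theorem geometric_mean_of_ne_one {ω : F} (hω : ω ^ 2 ^ s = 1) (hω1 : ω ≠ 1) :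
    (1 / 2 ^ s) * ∑ j ∈ Finset.range (2 ^ s), ω ^ j = 0 := by
  rw [geom_sum_eq hω1, hω, sub_self, zero_div, mul_zero]

/-- The sum splits into the geometric means of `v * w` and `v⁻¹ * w`. Since `v ≠ v⁻¹`, exactly one
ratio is 1; for `v = ± 1` both would be, and the value would double. -/
theorem paired_geometric_mean_of_eq (h2 : (2 : F) ≠ 0) {v w : F} (hv : v ≠ 0) (hv2 : v ^ 2 ≠ 1)
    (h1 : (v * w) ^ 2 ^ s = 1) (h1' : (v⁻¹ * w) ^ 2 ^ s = 1) (hw : w = v ∨ w = v⁻¹) :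
    (1 / 2 ^ s) * ∑ j ∈ Finset.range (2 ^ s), (v ^ j + v⁻¹ ^ j) * w ^ j = 1 := by
  simp only [add_mul, ← mul_pow, Finset.sum_add_distrib, mul_add]
  rcases hw with rfl | rfl
  · rw [geometric_mean_of_ne_one h1 (by rwa [← sq]),
      geometric_mean_of_eq_one h2 (inv_mul_cancel₀ hv), zero_add]
  · rw [geometric_mean_of_eq_one h2 (mul_inv_cancel₀ hv),
      geometric_mean_of_ne_one h1' (by rwa [← sq, inv_pow, ne_eq, inv_eq_one]), add_zero]

theorem paired_geometric_mean_of_ne {v w : F} (hv : v ≠ 0)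
    (h1 : (v * w) ^ 2 ^ s = 1) (h1' : (v⁻¹ * w) ^ 2 ^ s = 1) (hw : ¬ (w = v ∨ w = v⁻¹)) :
    (1 / 2 ^ s) * ∑ j ∈ Finset.range (2 ^ s), (v ^ j + v⁻¹ ^ j) * w ^ j = 0 := by
  push Not at hw
  simp only [add_mul, ← mul_pow, Finset.sum_add_distrib, mul_add]
  rw [geometric_mean_of_ne_one h1 fun h => hw.2 (eq_inv_of_mul_eq_one_right h),
    geometric_mean_of_ne_one h1' fun h => hw.1 ((inv_mul_eq_one₀ hv).1 h).symm, add_zero]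

theorem eq_of_pow_eq_or_eq_inv {η : F} {t : ℕ} (hη : IsPrimitiveRoot η (2 ^ (t + 1))) {i j : ℕ}
    (hi : i ≤ 2 ^ t) (hj : j ≤ 2 ^ t) (h : η ^ i = η ^ j ∨ η ^ i = (η ^ j)⁻¹) : i = j := by
  have ht : 0 < 2 ^ t := by positivity
  have hs : 2 ^ (t + 1) = 2 * 2 ^ t := pow_succ' 2 t
  rcases h with h | h
  · exact hη.pow_inj (by omega) (by omega) h
  · have h' : η ^ (i + j) = 1 := by
      rw [pow_add, h, inv_mul_cancel₀ (pow_ne_zero _ (hη.ne_zero (by positivity)))]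
    -- As `i + j ≤ 2 ^ (t + 1)`, divisibility leaves only `i = j = 0` and `i = j = 2 ^ t`, the two
    -- self-inverse powers.
    obtain ⟨q, hq⟩ := (hη.pow_eq_one_iff_dvd _).1 h'
    rw [hs] at hq
    rcases q with _ | _ | q
    · omega
    · omega
    · exfalso
      have : 2 * 2 ^ t * (q + 1 + 1) = 2 * 2 ^ t * q + 2 * (2 * 2 ^ t) := by ring
      have := Nat.zero_le (2 * 2 ^ t * q)
      omega

theorem exists_le_pow_eq_or_eq_inv {η : F} {t : ℕ} (hη : IsPrimitiveRoot η (2 ^ (t + 1))) {w : F}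
    (hw : w ^ 2 ^ (t + 1) = 1) : ∃ k ≤ 2 ^ t, w = η ^ k ∨ w = (η ^ k)⁻¹ := by
  have hs : 2 ^ (t + 1) = 2 * 2 ^ t := pow_succ' 2 t
  obtain ⟨k, hk, rfl⟩ := hη.eq_pow_of_pow_eq_one hw
  by_cases h : k ≤ 2 ^ t
  · exact ⟨k, h, Or.inl rfl⟩
  · refine ⟨2 ^ (t + 1) - k, by omega, Or.inr (eq_inv_of_mul_eq_one_left ?_)⟩
    rw [← pow_add, Nat.add_sub_cancel' hk.le, hη.pow_eq_one]

theorem IsPrimitiveRoot.pow_two_pow_eq_neg_one {η : F} {t : ℕ}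
    (hη : IsPrimitiveRoot η (2 ^ (t + 1))) : η ^ 2 ^ t = -1 := by
  have h := hη.pow_eq_one
  rw [pow_succ, pow_mul] at h
  refine (mul_self_eq_one_iff.1 ((sq _).symm.trans h)).resolve_left fun h1 => ?_
  have := Nat.le_of_dvd (by positivity) ((hη.pow_eq_one_iff_dvd _).1 h1)
  rw [pow_succ] at this
  have : 0 < 2 ^ t := by positivity
  omega

end GeometricMean

/-! ### The four cases of the theorem. -/

theorem theorem3p1 {K : Type*} [Field K] (hchar : ringChar K ≠ 2)
    (hK : IsFieldOfSecondKind K 2)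
    (ε : ℕ → AlgebraicClosure K) (hε : ∀ m, IsPrimitiveRoot (ε m) (2 ^ m))
    {G : Type*} [Group G] (n : ℕ) (g : G) (hg : ∀ x : G, x ∈ Subgroup.zpowers g)
    (hcard : Nat.card G = 2 ^ n)
    {A : Type*} [Ring A] [Algebra K A]
    (u : Module.Basis G K A) (hu : IsTwistedGroupBasis u)
    (a : K) (ha : a ≠ 0) (hga : u g ^ (2 ^ n) = algebraMap K A a)
    (s : ℕ) (hs : twoHeight (IntermediateField.adjoin K {ε 2}) n a = s) :
    -- case 1
    (IntermediateField.adjoin K {ε 2} = ⊥ →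
      (∃ b : K, b ^ (2 ^ s) = a) ∧
      ∀ b : K, b ^ (2 ^ s) = a →
        ∃ c : ℕ → ℕ → K,
          (∀ i j : ℕ, algebraMap K (AlgebraicClosure K) (c i j)
            = ε s ^ (-((i : ℤ) * (j : ℤ)))) ∧
          Set.BijOn (fun i => cyclicSum n s b (u g) (c i))
            {i | i < 2 ^ s} {e : A | IsMinimalIdempotent e}) ∧
    -- case 2
    (IntermediateField.adjoin K {ε 2} ≠ ⊥ →
      (s = 0 ∨ (s = 1 ∧ IsElementOfSecondKind s a)) →
        {e : A | IsMinimalIdempotent e} = {1}) ∧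
    -- case 3
    (IntermediateField.adjoin K {ε 2} ≠ ⊥ → 1 ≤ s → IsElementOfFirstKind s a →
      ∀ b : K, b ^ (2 ^ s) = a →
        ∃ c : ℕ → ℕ → K,
          (∀ i j : ℕ, algebraMap K (AlgebraicClosure K) (c i j)
            = ε s ^ ((i : ℤ) * (j : ℤ)) + ε s ^ (-((i : ℤ) * (j : ℤ)))) ∧
          {e : A | IsMinimalIdempotent e} =
            {cyclicSum n s b (u g) (fun _ => 1), cyclicSum n s b (u g) (fun j => (-1) ^ j)} ∪
              (fun i => cyclicSum n s b (u g) (c i)) '' {i | 1 ≤ i ∧ i < 2 ^ (s - 1)} ∧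
          -- the listed idempotents are pairwise distinct
          cyclicSum n s b (u g) (fun _ => 1) ≠ cyclicSum n s b (u g) (fun j => (-1) ^ j) ∧
          Set.InjOn (fun i => cyclicSum n s b (u g) (c i)) {i | 1 ≤ i ∧ i < 2 ^ (s - 1)} ∧
          (∀ i : ℕ, 1 ≤ i → i < 2 ^ (s - 1) →
            cyclicSum n s b (u g) (c i) ≠ cyclicSum n s b (u g) (fun _ => 1) ∧
            cyclicSum n s b (u g) (c i) ≠ cyclicSum n s b (u g) (fun j => (-1) ^ j))) ∧
    -- case 4
    (IntermediateField.adjoin K {ε 2} ≠ ⊥ → 2 ≤ s → IsElementOfSecondKind s a →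
      ε (s + 1) ^ 2 = ε s →
      ∀ b : K, -b ^ (2 ^ s) = a →
        ∃ c : ℕ → ℕ → K,
          (∀ i j : ℕ, algebraMap K (AlgebraicClosure K) (c i j)
            = (ε s ^ ((i : ℤ) * (j : ℤ) + (j : ℤ)) + ε s ^ (-((i : ℤ) * (j : ℤ))))
              * ε (s + 1) ^ (-(j : ℤ))) ∧
          Set.BijOn (fun i => cyclicSum n s b (u g) (c i))
            {i | i < 2 ^ (s - 1)} {e : A | IsMinimalIdempotent e}) := by
  classical
  have h2 : (2 : K) ≠ 0 := Ring.two_ne_zero hchar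
  have h2' : (2 : AlgebraicClosure K) ≠ 0 := by
    have := (map_ne_zero (algebraMap K (AlgebraicClosure K))).2 h2
    rwa [map_ofNat] at this
  set L := IntermediateField.adjoin K {ε 2} with hL
  have hι : ε 2 ^ 2 = -1 := (hε 2).pow_two_pow_eq_neg_one (t := 1)
  have hιL : ε 2 ∈ L := IntermediateField.mem_adjoin_simple_self K _
  have hrootL : ∀ (m : ℕ) (z : AlgebraicClosure K), z ^ 2 ^ m = 1 → z ∈ L :=
      mem_adjoin_of_two_pow_eq_one hK hε
  have hsn : s ≤ n := hs ▸ twoHeight_le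
  have hmax : s < n → ∀ α ∈ L, α ^ 2 ^ (s + 1) ≠ algebraMap K (AlgebraicClosure K) a := by
    subst hs
    exact pow_ne_of_twoHeight_lt
  obtain ⟨α, hαL, hα⟩ : ∃ α ∈ L, α ^ 2 ^ s = algebraMap K (AlgebraicClosure K) a :=
      hs ▸ exists_pow_twoHeight_eq
  have ha' : algebraMap K (AlgebraicClosure K) a ≠ 0 := (map_ne_zero _).2 ha
  have hα0 : α ≠ 0 := by
    rintro rfl
    exact ha' (by rw [← hα, zero_pow (by positivity)])
  have hroot : ∀ y : AlgebraicClosure K, y ^ 2 ^ s = algebraMap K (AlgebraicClosure K) a →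
      y ∈ L := fun y hy => by
    have : y / α ∈ L := hrootL s _ (by rw [div_pow, hy, hα, div_self ha'])
    simpa [div_mul_cancel₀ _ hα0] using mul_mem this hαL
  have hη0 : ∀ m, ε m ≠ 0 := fun m => (hε m).ne_zero (by positivity)
  have hz : ∀ (m i j : ℕ), ε m ^ ((i : ℤ) * (j : ℤ)) = (ε m ^ i) ^ j := fun m i j => by
    rw [zpow_mul, zpow_natCast, zpow_natCast]
  have hne0 : ∀ b : K, (b ^ 2 ^ s = a ∨ -b ^ 2 ^ s = a) →
      algebraMap K (AlgebraicClosure K) b ≠ 0 := by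
    rintro b hb h
    rw [map_eq_zero] at h
    subst h
    rw [zero_pow (by positivity), neg_zero, or_self] at hb
    exact ha hb.symm
  have core := fun (J : Set ℕ) (E : ℕ → A) (P : ℕ → AlgebraicClosure K → Prop) =>
    bijOn_isMinimalIdempotent_of_conjugate_supports h2 L hιL hι hg hcard hu ha hga hsn hmax hroot
      J E P
  refine ⟨fun hbot => ⟨?_, fun b hb => ?_⟩, fun hbot hcase => ?_, fun hbot hs1 _ b hb => ?_,
    fun hbot hs2 _ hεs b hb => ?_⟩
  · rw [hbot, IntermediateField.mem_bot] at hαL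
    obtain ⟨b, rfl⟩ := hαL
    exact ⟨b, (algebraMap K (AlgebraicClosure K)).injective (by rw [map_pow, hα])⟩
  · have hb0 := hne0 b (Or.inl hb)
    have hba : algebraMap K (AlgebraicClosure K) b ^ 2 ^ s =
        algebraMap K (AlgebraicClosure K) a := by
      rw [← map_pow, hb]
    have hw : ∀ y : AlgebraicClosure K, y ^ 2 ^ s = algebraMap K (AlgebraicClosure K) a →
        (y / algebraMap K (AlgebraicClosure K) b) ^ 2 ^ s = 1 :=
      fun y hy => by rw [div_pow, hy, hba, div_self ha']
    have hc : ∀ i j : ℕ, ∃ k : K, algebraMap K (AlgebraicClosure K) k = ε s ^ (-((i : ℤ) * (j : ℤ))) :=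
        fun i j => by
      have : ε s ^ (-((i : ℤ) * (j : ℤ))) ∈ L :=
        zpow_mem (hrootL s _ (hε s).pow_eq_one) _
      rwa [hbot, IntermediateField.mem_bot] at this
    choose c hc using hc
    have hval : ∀ (i : ℕ) (φ : A →ₐ[K] AlgebraicClosure K), φ (cyclicSum n s b (u g) (c i)) =
        (1 / 2 ^ s) * ∑ j ∈ Finset.range (2 ^ s),
          ((ε s ^ i)⁻¹ * (φ (u g) ^ 2 ^ (n - s) / algebraMap K (AlgebraicClosure K) b)) ^ j :=
              fun i φ => by
      rw [map_cyclicSum]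
      simp only [hc, zpow_neg, hz, ← inv_pow, ← mul_pow]
    refine ⟨c, hc, core _ _ (fun i y => y / algebraMap K (AlgebraicClosure K) b = ε s ^ i)
        (fun i _ φ hy hP => ?_)
      (fun i _ φ hy hP => ?_) (fun i _ => ?_) (fun y hy => ?_) (fun i hi j hj y hy hP hP' => ?_)
      (fun i _ y y' _ _ hP hP' => ?_)⟩
    · rw [hval]
      exact geometric_mean_of_eq_one h2' (by rw [hP, inv_mul_cancel₀ (pow_ne_zero _ (hη0 s))])
    · rw [hval]
      refine geometric_mean_of_ne_one ?_ fun h =>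
        hP ((inv_mul_eq_one₀ (pow_ne_zero _ (hη0 s))).1 h).symm
      rw [mul_pow, hw _ hy, inv_pow, ← pow_mul, mul_comm i, pow_mul, (hε s).pow_eq_one]
      simp
    · refine ⟨ε s ^ i * algebraMap K (AlgebraicClosure K) b, ?_, mul_div_cancel_right₀ _ hb0⟩
      rw [mul_pow, hba, ← pow_mul, mul_comm i, pow_mul, (hε s).pow_eq_one, one_pow, one_mul]
    · obtain ⟨i, hi, h⟩ := (hε s).eq_pow_of_pow_eq_one (hw y hy)
      exact ⟨i, hi, h.symm⟩
    · exact (hε s).pow_inj hi hj (hP.symm.trans hP')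
    · refine ⟨.refl, ?_⟩
      have : y / algebraMap K (AlgebraicClosure K) b = y' / algebraMap K (AlgebraicClosure K) b :=
          hP.trans hP'.symm
      exact (div_left_inj' hb0).1 this
  -- A single block: all `y` must be conjugate. For `s = 0` there is only one; for `s = 1` they are
  -- `± ε 2 * b`, exchanged by conjugation.
  · have := core {0} (fun _ => 1) (fun _ _ => True) (fun _ _ φ _ _ => map_one φ)
      (fun _ _ _ _ h => absurd trivial h) (fun _ _ => ⟨α, hα, trivial⟩)
      (fun _ _ => ⟨0, rfl, trivial⟩) (fun i hi j hj _ _ _ _ => hi.trans hj.symm)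
      (fun _ _ y y' hy hy' _ _ => ?_)
    · simpa using this.image_eq.symm
    rcases hcase with rfl | ⟨rfl, b, hb⟩
    · exact ⟨.refl, by simpa using hy.trans hy'.symm⟩
    · have hnsq := neg_one_not_square_of_adjoin_ne_bot hι hbot
      obtain ⟨τ, hτ⟩ := exists_algEquiv_map_eq_neg hι hnsq
      have hyb : ∀ y : AlgebraicClosure K, y ^ 2 ^ 1 = algebraMap K (AlgebraicClosure K) a →
          y = ε 2 * algebraMap K (AlgebraicClosure K) b ∨
              y = -(ε 2 * algebraMap K (AlgebraicClosure K) b) := fun y hy =>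
        sq_eq_sq_iff_eq_or_eq_neg.1 (by
          rw [pow_one] at hy hb
          rw [hy, ← hb, mul_pow, hι, map_neg, map_pow, neg_one_mul])
      have hτy : τ y = -y := by rcases hyb y hy with h | h <;> simp [h, hτ]
      rcases sq_eq_sq_iff_eq_or_eq_neg.1 (hy.trans hy'.symm) with h | h
      · exact ⟨.refl, h⟩
      · exact ⟨τ, by rw [hτy, h, neg_neg]⟩
  all_goals
    have hnsq := neg_one_not_square_of_adjoin_ne_bot hι hbot
    obtain ⟨τ, hτ⟩ := exists_algEquiv_map_eq_neg hι hnsq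
    have hinv : ∀ {m : ℕ} {ζ : AlgebraicClosure K}, ζ ^ 2 ^ m = 1 → τ ζ = ζ⁻¹ := fun h =>
      map_eq_inv_of_two_pow_eq_one h2 hι hrootL hnsq τ hτ h
    -- Conjugation exchanges the two summands, so the coefficient descends to `K`.
    have hmem : ∀ (m k j : ℕ), ∃ d : K,
        algebraMap K (AlgebraicClosure K) d = (ε m ^ k) ^ j + (ε m ^ k)⁻¹ ^ j := fun m k j => by
      have hεL : ε m ∈ L := hrootL m _ (hε m).pow_eq_one
      refine exists_algebraMap_eq_of_fixed h2 hι τ hτ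
        (add_mem (pow_mem (pow_mem hεL _) _) (pow_mem (inv_mem (pow_mem hεL _)) _)) ?_
      simp only [map_add, map_pow, map_inv₀, hinv (hε m).pow_eq_one, inv_pow, inv_inv]
      exact add_comm _ _
    have hconj : ∀ (m k : ℕ) (b : K) (y y' : AlgebraicClosure K),
        algebraMap K (AlgebraicClosure K) b ≠ 0 →
        (y / algebraMap K (AlgebraicClosure K) b = ε m ^ k ∨
            y / algebraMap K (AlgebraicClosure K) b = (ε m ^ k)⁻¹) →
        (y' / algebraMap K (AlgebraicClosure K) b = ε m ^ k ∨
            y' / algebraMap K (AlgebraicClosure K) b = (ε m ^ k)⁻¹) →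
        ∃ σ : (AlgebraicClosure K) ≃ₐ[K] (AlgebraicClosure K), σ y = y' := by
      intro m k b y y' hb0 hy hy'
      have hτε : τ (ε m) = (ε m)⁻¹ := hinv (hε m).pow_eq_one
      simp only [div_eq_iff hb0] at hy hy'
      rcases hy with rfl | rfl <;> rcases hy' with rfl | rfl
      · exact ⟨.refl, rfl⟩
      · exact ⟨τ, by simp [hτε]⟩
      · exact ⟨τ, by simp [hτε]⟩
      · exact ⟨.refl, rfl⟩
    have hsq : ∀ {t k : ℕ}, 0 < k → k < 2 ^ t → (ε (t + 1) ^ k) ^ 2 ≠ 1 := fun {t k} hk hkt h => by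
      rw [← pow_mul, (hε _).pow_eq_one_iff_dvd, pow_succ] at h
      have := Nat.le_of_dvd (by omega) h
      omega
    have hb0 := hne0 b (by tauto)
  · obtain ⟨t, rfl⟩ : ∃ t, s = t + 1 := ⟨s - 1, by omega⟩
    have hba : algebraMap K (AlgebraicClosure K) b ^ 2 ^ (t + 1) =
        algebraMap K (AlgebraicClosure K) a := by
      rw [← map_pow, hb]
    have hw : ∀ y : AlgebraicClosure K, y ^ 2 ^ (t + 1) = algebraMap K (AlgebraicClosure K) a →
        (y / algebraMap K (AlgebraicClosure K) b) ^ 2 ^ (t + 1) = 1 :=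
      fun y hy => by rw [div_pow, hy, hba, div_self ha']
    have hε1 : ∀ i, (ε (t + 1) ^ i) ^ 2 ^ (t + 1) = 1 := fun i => by
      rw [← pow_mul, mul_comm, pow_mul, (hε _).pow_eq_one, one_pow]
    have ht0 : 0 < 2 ^ t := by positivity
    have hhalf : ε (t + 1) ^ 2 ^ t = -1 := (hε (t + 1)).pow_two_pow_eq_neg_one
    choose c hc using hmem (t + 1)
    let f₁ : A := cyclicSum n (t + 1) b (u g) (fun _ => 1)
    let f₂ : A := cyclicSum n (t + 1) b (u g) (fun j => (-1) ^ j)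
    -- Inversion classes of powers of `ε (t + 1)` are indexed by `0 ≤ i ≤ 2 ^ t`. The ends are the
    -- self-inverse roots `1` and `-1`, where the paired sum would be twice the idempotent; `f₁` and
    -- `f₂` stand there instead.
    let E : ℕ → A := fun i => if i = 0 then f₁ else if i = 2 ^ t then f₂ else
      cyclicSum n (t + 1) b (u g) (c i)
    have hE0 : E 0 = f₁ := if_pos rfl
    have hEt : E (2 ^ t) = f₂ := by simp [E]
    have hEi : ∀ i, 0 < i → i < 2 ^ t → E i = cyclicSum n (t + 1) b (u g) (c i) :=
        fun i hi hit => by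
      simp [E, hi.ne', hit.ne]
    have hval1 : ∀ φ : A →ₐ[K] AlgebraicClosure K, φ f₁ =
        (1 / 2 ^ (t + 1)) * ∑ j ∈ Finset.range (2 ^ (t + 1)),
        (φ (u g) ^ 2 ^ (n - (t + 1)) / algebraMap K (AlgebraicClosure K) b) ^ j := fun φ => by
      simp [f₁, map_cyclicSum]
    have hval2 : ∀ φ : A →ₐ[K] AlgebraicClosure K, φ f₂ =
        (1 / 2 ^ (t + 1)) * ∑ j ∈ Finset.range (2 ^ (t + 1)),
        (-(φ (u g) ^ 2 ^ (n - (t + 1)) / algebraMap K (AlgebraicClosure K) b)) ^ j := fun φ => by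
      simp [f₂, map_cyclicSum, ← mul_pow]
    have hbij : Set.BijOn E {i | i ≤ 2 ^ t} {e | IsMinimalIdempotent e} := by
      refine core _ _ (fun i y => y / algebraMap K (AlgebraicClosure K) b = ε (t + 1) ^ i ∨
        y / algebraMap K (AlgebraicClosure K) b = (ε (t + 1) ^ i)⁻¹) (fun i hi φ hy hP => ?_)
        (fun i hi φ hy hP => ?_) (fun i _ => ?_) (fun y hy => ?_)
        (fun i hi j hj y hy hP hP' => ?_) (fun i _ y y' _ _ hP hP' => hconj _ i b y y' hb0 hP hP')
      · rcases Nat.eq_zero_or_pos i with rfl | hi0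
        · rw [hE0, hval1]
          exact geometric_mean_of_eq_one h2' (by simpa using hP)
        rcases (show i ≤ 2 ^ t from hi).eq_or_lt with rfl | hit
        · rw [hEt, hval2]
          refine geometric_mean_of_eq_one h2' ?_
          rw [hhalf, inv_neg, inv_one, or_self] at hP
          rw [hP, neg_neg]
        · rw [hEi i hi0 hit, map_cyclicSum]
          simp only [hc]
          exact paired_geometric_mean_of_eq h2' (pow_ne_zero _ (hη0 _)) (hsq hi0 hit)
            (by rw [mul_pow, hw _ hy, hε1, one_mul])
            (by rw [mul_pow, hw _ hy, inv_pow, hε1, inv_one, one_mul]) hP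
      · rcases Nat.eq_zero_or_pos i with rfl | hi0
        · rw [hE0, hval1]
          exact geometric_mean_of_ne_one (hw _ hy) (by simpa using hP)
        rcases (show i ≤ 2 ^ t from hi).eq_or_lt with rfl | hit
        · rw [hEt, hval2]
          rw [hhalf, inv_neg, inv_one, or_self] at hP
          refine geometric_mean_of_ne_one ?_ fun h => hP (by rw [← h, neg_neg])
          rw [pow_succ', pow_mul, neg_sq, ← pow_mul, ← pow_succ', hw _ hy]
        · rw [hEi i hi0 hit, map_cyclicSum]
          simp only [hc]
          exact paired_geometric_mean_of_ne (pow_ne_zero _ (hη0 _))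
            (by rw [mul_pow, hw _ hy, hε1, one_mul])
            (by rw [mul_pow, hw _ hy, inv_pow, hε1, inv_one, one_mul]) hP
      · exact ⟨ε (t + 1) ^ i * algebraMap K (AlgebraicClosure K) b,
          by rw [mul_pow, hba, hε1, one_mul],
          Or.inl (mul_div_cancel_right₀ _ hb0)⟩
      · exact exists_le_pow_eq_or_eq_inv (hε _) (hw y hy)
      · refine eq_of_pow_eq_or_eq_inv (hε _) hi hj ?_
        rcases hP with hP | hP <;> rcases hP' with hP' | hP'
        · exact Or.inl (hP.symm.trans hP')
        · exact Or.inr (hP.symm.trans hP')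
        · exact Or.inr (by rw [← hP', hP, inv_inv])
        · exact Or.inl (inv_injective (hP.symm.trans hP'))
    have hEne : ∀ {i j}, i ≤ 2 ^ t → j ≤ 2 ^ t → i ≠ j → E i ≠ E j := fun hi hj hij h =>
      hij (hbij.injOn hi hj h)
    refine ⟨c, fun i j => ?_, ?_, ?_, ?_, ?_⟩
    · rw [hc, zpow_neg, hz, inv_pow]
    · rw [← hbij.image_eq]
      rw [Nat.add_sub_cancel]
      ext e
      simp only [Set.mem_image, Set.mem_union, Set.mem_insert_iff, Set.mem_singleton_iff,
        Set.mem_ofPred_eq]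
      constructor
      · rintro ⟨i, hi, rfl⟩
        rcases Nat.eq_zero_or_pos i with rfl | hi0
        · exact Or.inl (Or.inl hE0)
        rcases hi.eq_or_lt with rfl | hit
        · exact Or.inl (Or.inr hEt)
        · exact Or.inr ⟨i, ⟨hi0, hit⟩, (hEi i hi0 hit).symm⟩
      · rintro ((rfl | rfl) | ⟨i, ⟨hi0, hit⟩, rfl⟩)
        · exact ⟨0, Nat.zero_le _, hE0⟩
        · exact ⟨2 ^ t, le_rfl, hEt⟩
        · exact ⟨i, hit.le, hEi i hi0 hit⟩
    · have := hEne (Nat.zero_le _) le_rfl ht0.ne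
      rwa [hE0, hEt] at this
    · rintro i ⟨hi0, hit⟩ j ⟨hj0, hjt⟩ h
      rw [Nat.add_sub_cancel] at hit hjt
      refine hbij.injOn hit.le hjt.le ?_
      rw [hEi i hi0 hit, hEi j hj0 hjt]
      exact h
    · intro i hi0 hit
      rw [Nat.add_sub_cancel] at hit
      rw [← hEi i hi0 hit]
      have h0 := hEne hit.le (Nat.zero_le _) (Nat.pos_iff_ne_zero.1 hi0)
      have ht := hEne hit.le le_rfl hit.ne
      rw [hE0] at h0
      rw [hEt] at ht
      exact ⟨h0, ht⟩
  · have hs' : 2 ^ s = 2 * 2 ^ (s - 1) := by rw [← pow_succ', Nat.sub_add_cancel (by omega)]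
    have hba : algebraMap K (AlgebraicClosure K) b ^ 2 ^ s =
        -algebraMap K (AlgebraicClosure K) a := by
      rw [← map_pow, ← map_neg, ← hb, neg_neg]
    have hw : ∀ y : AlgebraicClosure K, y ^ 2 ^ s = algebraMap K (AlgebraicClosure K) a →
        (y / algebraMap K (AlgebraicClosure K) b) ^ 2 ^ s = -1 :=
      fun y hy => by rw [div_pow, hy, hba, div_neg, div_self ha']
    have hpow : ∀ k, (ε (s + 1) ^ k) ^ 2 ^ s = (-1) ^ k := fun k => by
      rw [← pow_mul, mul_comm, pow_mul, (hε (s + 1)).pow_two_pow_eq_neg_one]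
    have hodd : ∀ i, (ε (s + 1) ^ (2 * i + 1)) ^ 2 ^ s = -1 := fun i => by
      rw [hpow]
      exact Odd.neg_one_pow ⟨i, rfl⟩
    -- Here `y / b` is a `2 ^ s`-th root of `-1`, an odd power of `ε (s + 1)`, hence never
    -- self-inverse. The classes are given by the odd exponents `2 * i + 1 < 2 ^ s`, and with `ε s =
    -- ε (s + 1) ^ 2` the stated coefficients become these symmetric sums.
    choose c hc using fun i j : ℕ => hmem (s + 1) (2 * i + 1) j
    refine ⟨c, fun i j => ?_, core _ _
        (fun i y => y / algebraMap K (AlgebraicClosure K) b = ε (s + 1) ^ (2 * i + 1) ∨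
      y / algebraMap K (AlgebraicClosure K) b = (ε (s + 1) ^ (2 * i + 1))⁻¹)
          (fun i (hi : i < _) φ hy hP => ?_)
      (fun i (hi : i < _) φ hy hP => ?_) (fun i _ => ?_) (fun y hy => ?_)
      (fun i (hi : i < _) j (hj : j < _) y hy hP hP' => ?_)
      (fun i _ y y' _ _ hP hP' => hconj _ _ b y y' hb0 hP hP')⟩
    · have hζ : ε s = ε (s + 1) ^ (2 : ℤ) := by rw [← hεs, zpow_ofNat]
      rw [hc, hζ, ← zpow_mul, ← zpow_mul, add_mul, ← zpow_add₀ (hη0 _), ← zpow_add₀ (hη0 _),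
        inv_pow, ← hz, ← zpow_neg]
      congr 2 <;> push_cast <;> ring
    · rw [map_cyclicSum]
      simp only [hc]
      exact paired_geometric_mean_of_eq h2' (pow_ne_zero _ (hη0 _)) (hsq (by omega) (by omega))
        (by rw [mul_pow, hw _ hy, hodd]; norm_num)
        (by rw [mul_pow, hw _ hy, inv_pow, hodd]; norm_num) hP
    · rw [map_cyclicSum]
      simp only [hc]
      exact paired_geometric_mean_of_ne (pow_ne_zero _ (hη0 _))
        (by rw [mul_pow, hw _ hy, hodd]; norm_num)
        (by rw [mul_pow, hw _ hy, inv_pow, hodd]; norm_num) hP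
    · exact ⟨ε (s + 1) ^ (2 * i + 1) * algebraMap K (AlgebraicClosure K) b,
        by rw [mul_pow, hba, hodd, neg_one_mul, neg_neg], Or.inl (mul_div_cancel_right₀ _ hb0)⟩
    · have hneg : (-1 : AlgebraicClosure K) ≠ 1 := fun h => h2' (by linear_combination -h)
      obtain ⟨k, hk, hky⟩ := exists_le_pow_eq_or_eq_inv (hε (s + 1))
        (w := y / algebraMap K (AlgebraicClosure K) b) (by rw [pow_succ, pow_mul, hw y hy, neg_one_sq])
      have hk1 : (-1 : AlgebraicClosure K) ^ k = -1 := by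
        have := hw y hy
        rcases hky with h | h
        · rwa [h, hpow] at this
        · rwa [h, inv_pow, hpow, inv_eq_iff_eq_inv, inv_neg, inv_one] at this
      rcases Nat.even_or_odd' k with ⟨i, rfl | rfl⟩
      · exact absurd (by rw [← hk1, pow_mul, neg_one_sq, one_pow]) hneg
      · exact ⟨i, show i < 2 ^ (s - 1) by omega, hky⟩
    · have : 2 * i + 1 = 2 * j + 1 := by
        refine eq_of_pow_eq_or_eq_inv (hε (s + 1)) (by omega) (by omega) ?_
        rcases hP with hP | hP <;> rcases hP' with hP' | hP'
        · exact Or.inl (hP.symm.trans hP')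
        · exact Or.inr (hP.symm.trans hP')
        · exact Or.inr (by rw [← hP', hP, inv_inv])
        · exact Or.inl (inv_injective (hP.symm.trans hP'))
      omega
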